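/- Let $F_q$ be a finite field, let $n$ be a natural number, and let $M_n(F_q)$ be the ring of $n\times n$ matrices over $F_q$. For $X\in M_n(F_q)$ write $[X]=\{AX : A\in M_n(F_q)\}$ for the left ideal generated by $X$. Let $\Gamma$ be the directed graph with vertex set $M_n(F_q)$ in which there is an edge from $X$ to a distinct vertex $Y$ if and only if $[X]\subsetneq[Y]$. An automorphism of $\Gamma$ is a permutation $f$ of $M_n(F_q)$ such that, for all $X,Y$, there is an edge from $f(X)$ to $f(Y)$ if and only if there is an edge from $X$ to $Y$. (1) The following permutations of $M_n(F_q)$ are automorphisms of $\Gamma$: (a) for every invertible matrix $P\in M_n(F_q)$, the map $\varphi_P(X)=XP$; (b) for every field automorphism $\Upsilon$ of $F_q$, the map, also denoted $\Upsilon$, sending $X=[x_{ij}]$ to $\Upsilon(X)=[\Upsilon(x_{ij})]$; (c) every permutation $\sigma$ of $M_n(F_q)$ with $[\sigma(X)]=[X]$ for all $X$. (2) If $n\ge 3$, then for every automorphism $\Psi$ of $\Gamma$ there exist an invertible matrix $P\in M_n(F_q)$, a field automorphism $\Upsilon$ of $F_q$, and a permutation $\sigma$ of $M_n(F_q)$ with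 $[\sigma(X)]=[X]$ for all $X$, such that $\Psi=\varphi_P\circ\Upsilon\circ\sigma$, that is, $\Psi(X)=\Upsilon(\sigma(X))\,P$ for all $X\in M_n(F_q)$. -/

import Mathlib

/-- The left-ideal relation digraph of a ring `R`: the vertices are the elements of `R`, and there
is an edge from `x` to a distinct `y` iff the left ideal generated by `x` is properly contained in
the left ideal generated by `y`. (Mathlib's `Ideal R` is the type of left ideals of `R`.) -/
def leftIdealRelationDigraph (R : Type*) [Ring R] : Digraph R where
  Adj x y := x ≠ y ∧ Ideal.span {x} < Ideal.span {y}

/-- The automorphism group of a digraph: the permutations `f` of the vertex set such that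
`f u → f v` iff `u → v`. The product is composition of maps. -/
def digraphAut {V : Type*} (G : Digraph V) : Subgroup (Equiv.Perm V) where
  carrier := {f | ∀ u v, G.Adj (f u) (f v) ↔ G.Adj u v}
  one_mem' := fun _ _ => Iff.rfl
  mul_mem' := fun {f g} hf hg u v => (hf (g u) (g v)).trans (hg u v)
  inv_mem' := fun {f} hf u v => by
    have h := hf (f.symm u) (f.symm v)
    rw [Equiv.apply_symm_apply, Equiv.apply_symm_apply] at h
    exact h.symm

/-- Right multiplication `X ↦ X * P` by an invertible matrix `P`. -/
def rightMulPerm {F : Type*} [Field F] {n : ℕ} (P : GL (Fin n) F) :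
    Equiv.Perm (Matrix (Fin n) (Fin n) F) where
  toFun X := X * (P : Matrix (Fin n) (Fin n) F)
  invFun X := X * ((P⁻¹ : GL (Fin n) F) : Matrix (Fin n) (Fin n) F)
  left_inv X := Units.mul_inv_cancel_right X P
  right_inv X := Units.inv_mul_cancel_right X P

/-- Entrywise application of a field automorphism `υ` to a square matrix. -/
def entrywisePerm {F : Type*} [Field F] (n : ℕ) (υ : F ≃+* F) :
    Equiv.Perm (Matrix (Fin n) (Fin n) F) where
  toFun X := X.map υ
  invFun X := X.map υ.symm
  left_inv X := by ext i j; simp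
  right_inv X := by ext i j; simp

/-- The permutation `σ` of `R` maps each class of elements generating the same left ideal
to itself. -/
def PermutesLeftIdealClasses {R : Type*} [Ring R] (σ : Equiv.Perm R) : Prop :=
  ∀ x : R, Ideal.span {σ x} = Ideal.span {x}

/-! ### Principal left ideals of a ring. -/

section LeftIdeals

variable {R : Type*} [Ring R]

/-! One matrix is a left multiple of another exactly when its row space is contained in the other's,
and every subspace of `F ^ n` is a row space. The digraph is thus the strict inclusion order on
subspaces, pulled back along `rowSpace`, and part (1) is a matter of preserving left divisibility.

For part (2), strict inclusion must first detect equality of row spaces. In dimension at least 3 a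
subspace is determined by the subspaces strictly below and strictly above it
(`Submodule.le_of_forall_lt_iff`); in dimension 2 this fails, since all lines look alike. So `Ψ`
descends to an automorphism `φ` of the subspace lattice. The fundamental theorem of projective
geometry (`exists_semilinear_of_orderIso`) makes `φ` semilinear, hence induced by some `P` and `υ`;
what remains of `Ψ` fixes every row space and is `σ`.

The fundamental theorem is proved by splitting `V` as a line spanned by `a` plus a hyperplane `ker
ℓ`. Asking that `a + w` go to the line of `a' + u` singles out one vector `u` on the image of the
line of each nonzero `w` in `ker ℓ`; this choice is additive and then semilinear. -/

theorem leftIdealRelationDigraph_adj {x y : R} :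
    (leftIdealRelationDigraph R).Adj x y ↔ Ideal.span {x} < Ideal.span {y} :=
  ⟨fun h => h.2, fun h => ⟨fun e => by simp [e] at h, h⟩⟩

theorem Ideal.span_singleton_le_iff_exists_mul {x y : R} :
    Ideal.span {x} ≤ Ideal.span {y} ↔ ∃ a, a * y = x := by
  rw [Ideal.span_singleton_le_iff_mem, Ideal.mem_span_singleton']

theorem mem_digraphAut_of_le_iff {f : Equiv.Perm R}
    (h : ∀ x y : R, Ideal.span {f x} ≤ Ideal.span {f y} ↔ Ideal.span {x} ≤ Ideal.span {y}) :
    f ∈ digraphAut (leftIdealRelationDigraph R) := fun x y => by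
  rw [leftIdealRelationDigraph_adj, leftIdealRelationDigraph_adj, lt_iff_le_not_ge,
    lt_iff_le_not_ge, h, h]

end LeftIdeals

/-! ### Left ideals of matrices as row spaces. -/

section RowSpace

variable {F : Type*} [Field F] {n : ℕ}

/-- The row space of a square matrix. -/
def rowSpace (X : Matrix (Fin n) (Fin n) F) : Submodule F (Fin n → F) :=
  ⨆ i, Submodule.span F {X i}

theorem rowSpace_eq_range (X : Matrix (Fin n) (Fin n) F) :
    rowSpace X = LinearMap.range X.vecMulLinear := by
  rw [range_vecMulLinear, rowSpace, Submodule.span_range_eq_iSup]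
  rfl

theorem span_le_span_iff_rowSpace_le {X Y : Matrix (Fin n) (Fin n) F} :
    Ideal.span {X} ≤ Ideal.span {Y} ↔ rowSpace X ≤ rowSpace Y := by
  rw [Ideal.span_singleton_le_iff_exists_mul]
  constructor
  · rintro ⟨A, rfl⟩
    rw [rowSpace_eq_range, rowSpace_eq_range]
    rintro _ ⟨v, rfl⟩
    exact ⟨Matrix.vecMul v A, by simp [Matrix.vecMul_vecMul]⟩
  · intro h
    have h' : ∀ i, ∃ v, Matrix.vecMul v Y = X i := fun i => by
      have hi : X i ∈ rowSpace Y :=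
        h (Submodule.mem_iSup_of_mem i (Submodule.mem_span_singleton_self _))
      rw [rowSpace_eq_range] at hi
      exact hi
    choose A hA using h'
    refine ⟨Matrix.of A, ?_⟩
    ext i j
    rw [← hA i]
    rfl

theorem span_eq_span_iff_rowSpace_eq {X Y : Matrix (Fin n) (Fin n) F} :
    Ideal.span {X} = Ideal.span {Y} ↔ rowSpace X = rowSpace Y := by
  rw [le_antisymm_iff, le_antisymm_iff, span_le_span_iff_rowSpace_le, span_le_span_iff_rowSpace_le]

theorem span_lt_span_iff_rowSpace_lt {X Y : Matrix (Fin n) (Fin n) F} :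
    Ideal.span {X} < Ideal.span {Y} ↔ rowSpace X < rowSpace Y := by
  rw [lt_iff_le_not_ge, lt_iff_le_not_ge, span_le_span_iff_rowSpace_le,
    span_le_span_iff_rowSpace_le]

/-- A subspace is the range of a projection onto it, and the matrix of that projection is square. -/
theorem rowSpace_surjective :
    Function.Surjective (rowSpace : Matrix (Fin n) (Fin n) F → Submodule F (Fin n → F)) := by
  intro W
  obtain ⟨W', hW⟩ := Submodule.exists_isCompl W
  let p := W.projectionOnto W' hW
  refine ⟨LinearMap.toMatrix' (W.subtype ∘ₗ p) |>.transpose, ?_⟩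
  rw [rowSpace_eq_range]
  have : (LinearMap.toMatrix' (W.subtype ∘ₗ p)).transpose.vecMulLinear = W.subtype ∘ₗ p := by
    refine LinearMap.ext fun v => ?_
    rw [Matrix.vecMulLinear_apply, Matrix.vecMul_transpose, LinearMap.toMatrix'_mulVec]
  rw [this, LinearMap.range_comp, Submodule.range_projectionOnto, Submodule.map_subtype_top]

end RowSpace

/-! ### Recovering the subspace lattice from strict inclusion. -/

section StrictOrder

variable {F V : Type*} [Field F] [AddCommGroup V] [Module F V]

theorem exists_notMem_span_sup (h3 : 3 ≤ Module.finrank F V) (u v : V) :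
    ∃ x, x ∉ Submodule.span F {u} ⊔ Submodule.span F {v} := by
  by_contra! h
  have htop : Submodule.span F {u, v} = ⊤ := by
    rw [Submodule.span_insert]
    exact (Submodule.eq_top_iff').2 h
  classical
  have h2 := finrank_span_finset_le_card (R := F) ({u, v} : Finset V)
  have h4 : (({u, v} : Finset V) : Set V) = {u, v} := by simp
  rw [h4] at h2
  change Module.finrank F (Submodule.span F {u, v}) ≤ _ at h2
  rw [htop, finrank_top] at h2
  have := Finset.card_le_two (a := u) (b := v)
  omega

/-- A vector `v` of `W` outside `W'` forces both subspaces to be lines, spanned by `v` and some `u`.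
A vector `x` off the span of `u` and `v` then gives a plane through `v` and `x` that contains `W`
but not `W'`. -/
theorem Submodule.le_of_forall_lt_iff (h3 : 3 ≤ Module.finrank F V) {W W' : Submodule F V}
    (hlt : ∀ U, U < W ↔ U < W') (hgt : ∀ U, W < U ↔ W' < U) : W ≤ W' := by
  intro v hv
  by_contra hv'
  have hle : ∀ {x : V} {U : Submodule F V}, x ∈ U → Submodule.span F {x} ≤ U := fun hx =>
    (Submodule.span_singleton_le_iff_mem _ _).2 hx
  have hself : ∀ x : V, x ∈ Submodule.span F {x} := Submodule.mem_span_singleton_self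
  have hv0 : v ≠ 0 := fun e => hv' (e ▸ W'.zero_mem)
  have hW : Submodule.span F {v} = W := by
    refine (hle hv).eq_or_lt.resolve_right fun h => hv' ?_
    exact ((hlt _).1 h).le (hself v)
  have hbot : W' ≠ ⊥ := fun e => by
    have h1 : (⊥ : Submodule F V) < W := by
      rw [← hW, bot_lt_iff_ne_bot, Ne, Submodule.span_singleton_eq_bot]
      exact hv0
    exact lt_irrefl _ (e ▸ (hlt _).1 h1)
  obtain ⟨u, hu, hu0⟩ := Submodule.exists_mem_ne_zero_of_ne_bot hbot
  have hW' : Submodule.span F {u} = W' := by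
    refine (hle hu).eq_or_lt.resolve_right fun h => hu0 ?_
    have h1 := (hlt _).2 h
    rw [← hW] at h1
    have h2 := (nonzero_span_atom v hv0).2 _ h1
    exact Submodule.span_singleton_eq_bot.1 h2
  obtain ⟨x, hx⟩ := exists_notMem_span_sup h3 u v
  have h1 : W < Submodule.span F {v} ⊔ Submodule.span F {x} := by
    rw [hW]
    refine lt_of_le_of_ne le_sup_left fun e => hx ?_
    have : x ∈ W := e ▸ (le_sup_right : _ ≤ W ⊔ _) (hself x)
    exact Submodule.mem_sup_right (hW ▸ this)
  have h2 : u ∈ Submodule.span F {v} ⊔ Submodule.span F {x} := ((hgt _).1 h1).le hu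
  rw [← Submodule.span_insert, Submodule.mem_span_pair] at h2
  obtain ⟨α, β, rfl⟩ := h2
  by_cases hβ : β = 0
  · subst hβ
    have hα : α ≠ 0 := fun e => hu0 (by simp [e])
    apply hv'
    have := W'.smul_mem α⁻¹ hu
    simpa [smul_smul, hα] using this
  · apply hx
    rw [← Submodule.span_insert, Submodule.mem_span_pair]
    refine ⟨β⁻¹, -(β⁻¹ * α), ?_⟩
    rw [smul_add, smul_smul, smul_smul, inv_mul_cancel₀ hβ, neg_smul]
    module

/-- A permutation preserving the strict order pulled back along a surjection onto the lattice of
subspaces, in dimension at least three, induces an automorphism of that lattice. -/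
theorem exists_orderIso_of_lt_iff {M : Type*} (h3 : 3 ≤ Module.finrank F V)
    {r : M → Submodule F V} (hr : Function.Surjective r) (f : Equiv.Perm M)
    (hf : ∀ x y, r (f x) < r (f y) ↔ r x < r y) :
    ∃ φ : Submodule F V ≃o Submodule F V, ∀ x, φ (r x) = r (f x) := by
  -- Since `r ∘ g` is onto, every subspace can be written `r (g z)`, so `r (g x)` and `r (g y)` have
  -- the same strict lower and upper bounds.
  have key : ∀ g : Equiv.Perm M, (∀ x y, r (g x) < r (g y) ↔ r x < r y) →
      ∀ x y, r x = r y → r (g x) = r (g y) := by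
    intro g hg
    have hle : ∀ x y, r x = r y → r (g x) ≤ r (g y) := by
      intro x y hxy
      apply Submodule.le_of_forall_lt_iff h3
      · intro U
        obtain ⟨z, rfl⟩ := hr U
        obtain ⟨z, rfl⟩ := g.surjective z
        rw [hg, hg, hxy]
      · intro U
        obtain ⟨z, rfl⟩ := hr U
        obtain ⟨z, rfl⟩ := g.surjective z
        rw [hg, hg, hxy]
    exact fun x y hxy => le_antisymm (hle x y hxy) (hle y x hxy.symm)
  have hf' : ∀ x y, r (f.symm x) < r (f.symm y) ↔ r x < r y := fun x y => by
    rw [← hf, f.apply_symm_apply, f.apply_symm_apply]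
  have heq : ∀ x y, r (f x) = r (f y) ↔ r x = r y := fun x y =>
    ⟨fun h => by simpa using key f.symm hf' _ _ h, key f hf x y⟩
  choose s hs using hr
  have hsr : ∀ x, r (f (s (r x))) = r (f x) := fun x => (heq _ _).2 (hs _)
  have hsr' : ∀ x, r (f.symm (s (r x))) = r (f.symm x) := fun x => key _ hf' _ _ (hs _)
  refine ⟨⟨⟨fun W => r (f (s W)), fun W => r (f.symm (s W)), fun W => ?_, fun W => ?_⟩, ?_⟩, hsr⟩
  · change r (f.symm (s (r _))) = _
    rw [hsr', f.symm_apply_apply, hs]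
  · change r (f (s (r _))) = _
    rw [hsr, f.apply_symm_apply, hs]
  · intro W W'
    change r (f (s W)) ≤ r (f (s W')) ↔ _
    rw [le_iff_lt_or_eq, le_iff_lt_or_eq, hf, heq, hs, hs]

end StrictOrder

/-! ### The fundamental theorem of projective geometry. -/

section FundamentalTheorem

variable {F V : Type*} [Field F] [AddCommGroup V] [Module F V]
  (φ : Submodule F V ≃o Submodule F V)

theorem exists_map_span_singleton (v : V) :
    ∃ w, φ (Submodule.span F {v}) = Submodule.span F {w} := by
  by_cases hv : v = 0
  · exact ⟨0, by simp [hv]⟩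
  · have h := (φ.isAtom_iff _).2 (nonzero_span_atom v hv)
    obtain ⟨w, -, hw⟩ := (atom_iff_nonzero_span _).1 h
    exact ⟨w, hw⟩

variable {φ}

theorem ne_zero_of_map_span_eq {v w : V} (h : φ (Submodule.span F {v}) = Submodule.span F {w})
    (hv : v ≠ 0) : w ≠ 0 := by
  rintro rfl
  rw [Submodule.span_zero_singleton, map_eq_bot_iff, Submodule.span_singleton_eq_bot] at h
  exact hv h

/-- Independence of nonzero vectors is independence of their lines in the lattice, which `φ`
preserves. -/
theorem LinearIndependent.of_map_span_eq {ι : Type*} {v w : ι → V}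
    (h : ∀ i, φ (Submodule.span F {v i}) = Submodule.span F {w i})
    (hv : LinearIndependent F v) : LinearIndependent F w := by
  have h1 := hv.iSupIndep_span_singleton.map_orderIso φ
  refine iSupIndep.linearIndependent (fun i => Submodule.span F {w i}) ?_ ?_ ?_
  · convert h1 using 2 with i
    exact (h i).symm
  · exact fun i => Submodule.mem_span_singleton_self _
  · exact fun i => ne_zero_of_map_span_eq (h i) (hv.ne_zero i)

/-- Being a combination of `x` and `y` is a lattice condition on lines: `span {z} ≤ span {x} ⊔ span
{y}`. -/
theorem exists_smul_add_smul_of_map_span_eq {x y z x' y' z' : V}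
    (hx : φ (Submodule.span F {x}) = Submodule.span F {x'})
    (hy : φ (Submodule.span F {y}) = Submodule.span F {y'})
    (hz : φ (Submodule.span F {z}) = Submodule.span F {z'})
    (h : ∃ c d : F, c • x + d • y = z) : ∃ c d : F, c • x' + d • y' = z' := by
  rw [← Submodule.mem_span_pair, Submodule.span_insert, ← hx, ← hy, ← map_sup,
    ← Submodule.span_insert, ← Submodule.span_singleton_le_iff_mem, ← hz, φ.le_iff_le,
    Submodule.span_singleton_le_iff_mem, Submodule.mem_span_pair]
  exact h

theorem exists_smul_eq_of_span_singleton_eq {x y : V}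
    (h : Submodule.span F {x} = Submodule.span F {y}) : ∃ c : F, c • x = y :=
  Submodule.mem_span_singleton.1 (h ▸ Submodule.mem_span_singleton_self y)

theorem span_singleton_smul_eq_of_ne_zero {c : F} (hc : c ≠ 0) (x : V) :
    Submodule.span F {c • x} = Submodule.span F {x} :=
  Submodule.span_singleton_smul_eq (IsUnit.mk0 c hc) x

theorem LinearIndependent.pair_ext {x y : V} (h : LinearIndependent F ![x, y]) {a b c d : F}
    (e : a • x + b • y = c • x + d • y) : a = c ∧ b = d := by
  have := LinearIndependent.pair_iff.1 h (a - c) (b - d) (by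
    rw [sub_smul, sub_smul, ← sub_eq_zero.2 e]; abel)
  exact ⟨sub_eq_zero.1 this.1, sub_eq_zero.1 this.2⟩

theorem LinearIndependent.triple_ext {x y z : V} (h : LinearIndependent F ![x, y, z])
    {a b c a' b' c' : F} (e : a • x + b • y + c • z = a' • x + b' • y + c' • z) :
    a = a' ∧ b = b' ∧ c = c' := by
  have := Fintype.linearIndependent_iff.1 h ![a - a', b - b', c - c'] (by
    rw [Fin.sum_univ_three, ← sub_eq_zero.2 e]
    simp only [Matrix.cons_val]
    module)
  exact ⟨sub_eq_zero.1 (this 0), sub_eq_zero.1 (this 1), sub_eq_zero.1 (this 2)⟩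

theorem LinearIndependent.map_span_pair {x y x' y' : V}
    (hx : φ (Submodule.span F {x}) = Submodule.span F {x'})
    (hy : φ (Submodule.span F {y}) = Submodule.span F {y'})
    (h : LinearIndependent F ![x, y]) : LinearIndependent F ![x', y'] := by
  refine LinearIndependent.of_map_span_eq (φ := φ) (v := ![x, y]) (fun i => ?_) h
  fin_cases i
  exacts [hx, hy]

theorem LinearIndependent.map_span_triple {x y z x' y' z' : V}
    (hx : φ (Submodule.span F {x}) = Submodule.span F {x'})
    (hy : φ (Submodule.span F {y}) = Submodule.span F {y'})
    (hz : φ (Submodule.span F {z}) = Submodule.span F {z'})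
    (h : LinearIndependent F ![x, y, z]) : LinearIndependent F ![x', y', z'] := by
  refine LinearIndependent.of_map_span_eq (φ := φ) (v := ![x, y, z]) (fun i => ?_) h
  fin_cases i
  exacts [hx, hy, hz]

/-- `u` is the image of `w`, normalised with respect to the images of `a` and `a + w`. -/
def IsNormalizedImage (φ : Submodule F V ≃o Submodule F V) (a a' w u : V) : Prop :=
  φ (Submodule.span F {w}) = Submodule.span F {u} ∧
    φ (Submodule.span F {a + w}) = Submodule.span F {a' + u}

variable {a a' : V}

theorem IsNormalizedImage.zero (ha : φ (Submodule.span F {a}) = Submodule.span F {a'}) :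
    IsNormalizedImage φ a a' 0 0 := by
  simp [IsNormalizedImage, ha]

theorem IsNormalizedImage.exists (ha : φ (Submodule.span F {a}) = Submodule.span F {a'})
    {w : V} (hw : LinearIndependent F ![a, w]) : ∃ u, IsNormalizedImage φ a a' w u := by
  obtain ⟨b, hb⟩ := exists_map_span_singleton φ w
  obtain ⟨s, hs⟩ := exists_map_span_singleton φ (a + w)
  obtain ⟨α, β, rfl⟩ := exists_smul_add_smul_of_map_span_eq ha hb hs ⟨1, 1, by simp⟩
  -- If a coefficient vanished, the independent lines of `a + w` and `w` (or `a`) would have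
  -- dependent images.
  have hα : α ≠ 0 := by
    rintro rfl
    have h1 : LinearIndependent F ![a + w, w] := LinearIndependent.pair_iff.2 fun c d h => by
      have := LinearIndependent.pair_iff.1 hw c (c + d) (by rw [← h]; module)
      refine ⟨this.1, ?_⟩
      simpa [this.1] using this.2
    have h2 := LinearIndependent.pair_iff.1 (h1.map_span_pair hs hb) 1 (-β) (by module)
    exact one_ne_zero h2.1
  have hβ : β ≠ 0 := by
    rintro rfl
    have h1 : LinearIndependent F ![a + w, a] := LinearIndependent.pair_iff.2 fun c d h => by
      have := LinearIndependent.pair_iff.1 hw (c + d) c (by rw [← h]; module)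
      refine ⟨this.2, ?_⟩
      simpa [this.2] using this.1
    have h2 := LinearIndependent.pair_iff.1 (h1.map_span_pair hs ha) 1 (-α) (by module)
    exact one_ne_zero h2.1
  refine ⟨(α⁻¹ * β) • b, ?_, ?_⟩
  · rw [hb, span_singleton_smul_eq_of_ne_zero (mul_ne_zero (inv_ne_zero hα) hβ)]
  · rw [hs, ← span_singleton_smul_eq_of_ne_zero (inv_ne_zero hα), smul_add, smul_smul, smul_smul,
      inv_mul_cancel₀ hα, one_smul]

theorem IsNormalizedImage.unique (ha : φ (Submodule.span F {a}) = Submodule.span F {a'})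
    {w u t : V} (hw : LinearIndependent F ![a, w]) (hu : IsNormalizedImage φ a a' w u)
    (ht : IsNormalizedImage φ a a' w t) : u = t := by
  obtain ⟨c, hc⟩ := exists_smul_eq_of_span_singleton_eq (ht.1.symm.trans hu.1)
  obtain ⟨d, hd⟩ := exists_smul_eq_of_span_singleton_eq (ht.2.symm.trans hu.2)
  have h := (hw.map_span_pair ha ht.1).pair_ext (a := d) (b := d) (c := 1) (d := c) (by
    rw [hc, one_smul, ← hd, smul_add])
  rw [← hc, ← h.2, h.1, one_smul]

/-- Sums are found by incidence: the line of `a + x + y` lies in the planes ⟨a + x, y⟩ and ⟨a + y,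
x⟩, and the line of `x + y` in ⟨x, y⟩ and ⟨a, a + x + y⟩. Comparing coefficients in the independent
triple `a', x', y'` fixes both images. -/
theorem IsNormalizedImage.add (ha : φ (Submodule.span F {a}) = Submodule.span F {a'})
    {x y x' y' : V} (h : LinearIndependent F ![a, x, y]) (hx : IsNormalizedImage φ a a' x x')
    (hy : IsNormalizedImage φ a a' y y') : IsNormalizedImage φ a a' (x + y) (x' + y') := by
  have hli := h.map_span_triple ha hx.1 hy.1
  have h2 : φ (Submodule.span F {a + (x + y)}) = Submodule.span F {a' + (x' + y')} := by
    obtain ⟨s, hs⟩ := exists_map_span_singleton φ (a + (x + y))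
    obtain ⟨α, β, h1⟩ := exists_smul_add_smul_of_map_span_eq hx.2 hy.1 hs ⟨1, 1, by module⟩
    obtain ⟨γ, δ, h2⟩ := exists_smul_add_smul_of_map_span_eq hy.2 hx.1 hs ⟨1, 1, by module⟩
    obtain ⟨e1, e2, e3⟩ := hli.triple_ext (a := α) (b := α) (c := β) (a' := γ) (b' := δ)
      (c' := γ) (by rw [← sub_eq_zero, ← sub_eq_zero.2 (h1.trans h2.symm)]; module)
    have hs' : s = α • (a' + (x' + y')) := by
      rw [← h1, e3, ← e1]; module
    have hα : α ≠ 0 := by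
      rintro rfl
      refine ne_zero_of_map_span_eq hs (fun h0 => ?_) (by rw [hs', zero_smul])
      have := h.triple_ext (a := 1) (b := 1) (c := 1) (a' := 0) (b' := 0) (c' := 0)
        (by rw [← sub_eq_zero]; rw [← h0]; module)
      exact one_ne_zero this.1
    rw [hs, hs', span_singleton_smul_eq_of_ne_zero hα]
  refine ⟨?_, h2⟩
  obtain ⟨s, hs⟩ := exists_map_span_singleton φ (x + y)
  obtain ⟨α, β, h1⟩ := exists_smul_add_smul_of_map_span_eq hx.1 hy.1 hs ⟨1, 1, by module⟩
  obtain ⟨γ, δ, h2⟩ := exists_smul_add_smul_of_map_span_eq ha h2 hs ⟨-1, 1, by module⟩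
  obtain ⟨e1, e2, e3⟩ := hli.triple_ext (a := 0) (b := α) (c := β) (a' := γ + δ) (b' := δ)
    (c' := δ) (by rw [← sub_eq_zero, ← sub_eq_zero.2 (h1.trans h2.symm)]; module)
  have hs' : s = α • (x' + y') := by
    rw [← h1, e3, ← e2]; module
  have hα : α ≠ 0 := by
    rintro rfl
    refine ne_zero_of_map_span_eq hs (fun h0 => ?_) (by rw [hs', zero_smul])
    have := h.triple_ext (a := 0) (b := 1) (c := 1) (a' := 0) (b' := 0) (c' := 0)
      (by rw [← sub_eq_zero]; rw [← h0]; module)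
    exact one_ne_zero this.2.1
  rw [hs, hs', span_singleton_smul_eq_of_ne_zero hα]

/-! ### Normalised images on the hyperplane `ker ℓ`. -/

section Hyperplane

variable {ℓ : V →ₗ[F] F}

theorem LinearIndependent.pair_of_apply_eq_one (hℓ : ℓ a = 1) {x : V} (hx : ℓ x = 0)
    (hx0 : x ≠ 0) : LinearIndependent F ![a, x] := by
  refine LinearIndependent.pair_iff.2 fun c d h => ?_
  have hc : c = 0 := by simpa [hℓ, hx] using congrArg ℓ h
  subst hc
  exact ⟨rfl, by simpa [hx0] using h⟩

theorem LinearIndependent.triple_of_apply_eq_one (hℓ : ℓ a = 1) {x y : V} (hx : ℓ x = 0)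
    (hy : ℓ y = 0) (h : LinearIndependent F ![x, y]) : LinearIndependent F ![a, x, y] := by
  refine Fintype.linearIndependent_iff.2 fun g hg => ?_
  rw [Fin.sum_univ_three] at hg
  simp only [Matrix.cons_val] at hg
  have hc : g 0 = 0 := by simpa [hℓ, hx, hy] using congrArg ℓ hg
  have := LinearIndependent.pair_iff.1 h (g 1) (g 2) (by simpa [hc] using hg)
  intro i
  fin_cases i
  exacts [hc, this.1, this.2]

theorem exists_linearIndependent_pair_of_apply_eq_one (h3 : 3 ≤ Module.finrank F V)
    (hℓ : ℓ a = 1) {x : V} (hx0 : x ≠ 0) :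
    ∃ z, ℓ z = 0 ∧ LinearIndependent F ![x, z] := by
  obtain ⟨z, hz⟩ := exists_notMem_span_sup h3 a x
  -- This is `z` projected to `ker ℓ` along `a`; as `z` avoids the span of `a` and `x`, the result
  -- is not a multiple of `x`.
  refine ⟨z - ℓ z • a, by simp [hℓ], ?_⟩
  refine (LinearIndependent.pair_iff' hx0).2 fun c hc => hz ?_
  rw [← Submodule.span_insert, Submodule.mem_span_pair]
  exact ⟨ℓ z, c, by rw [hc]; module⟩

theorem LinearIndependent.pair_of_not {x y z : V} (hxz : LinearIndependent F ![x, z])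
    (hxy : ¬ LinearIndependent F ![x, y]) (hy : y ≠ 0) : LinearIndependent F ![y, z] := by
  have hx : x ≠ 0 := hxz.ne_zero 0
  rw [LinearIndependent.pair_iff' hx] at hxy
  push Not at hxy
  obtain ⟨c, rfl⟩ := hxy
  have hc : c ≠ 0 := by rintro rfl; simp at hy
  refine LinearIndependent.pair_iff.2 fun s t h => ?_
  have := LinearIndependent.pair_iff.1 hxz (s * c) t (by rw [mul_smul]; exact h)
  exact ⟨(mul_eq_zero.1 this.1).resolve_right hc, this.2⟩

theorem exists_normalizedImage_additive (h3 : 3 ≤ Module.finrank F V) (hℓ : ℓ a = 1)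
    (ha : φ (Submodule.span F {a}) = Submodule.span F {a'}) :
    ∃ h : LinearMap.ker ℓ →+ V, ∀ w : LinearMap.ker ℓ, IsNormalizedImage φ a a' (w : V) (h w) := by
  have hex : ∀ w : LinearMap.ker ℓ, ∃ u, IsNormalizedImage φ a a' (w : V) u ∧ (w = 0 → u = 0) := by
    intro w
    by_cases hw : w = 0
    · exact ⟨0, hw ▸ .zero ha, fun _ => rfl⟩
    · obtain ⟨u, hu⟩ := IsNormalizedImage.exists ha
        (LinearIndependent.pair_of_apply_eq_one hℓ w.2 (by simpa using hw))
      exact ⟨u, hu, fun h => absurd h hw⟩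
  choose h hh h0 using hex
  have hadd : ∀ x y : LinearMap.ker ℓ, LinearIndependent F ![(x : V), (y : V)] →
      h (x + y) = h x + h y := by
    intro x y hxy
    refine IsNormalizedImage.unique ha ?_ (hh _)
      (.add ha (.triple_of_apply_eq_one hℓ x.2 y.2 hxy) (hh x) (hh y))
    refine .pair_of_apply_eq_one hℓ (x + y).2 fun e => ?_
    exact one_ne_zero (LinearIndependent.pair_iff.1 hxy 1 1 (by simpa using e)).1
  refine ⟨AddMonoidHom.mk' h fun x y => ?_, hh⟩
  by_cases hx : x = 0
  · rw [h0 x hx, hx, zero_add, zero_add]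
  by_cases hy : y = 0
  · rw [h0 y hy, hy, add_zero, add_zero]
  by_cases hxy : LinearIndependent F ![(x : V), (y : V)]
  · exact hadd x y hxy
  have hx' : (x : V) ≠ 0 := by simpa using hx
  have hy' : (y : V) ≠ 0 := by simpa using hy
  -- For dependent `x` and `y`, an auxiliary `z` off their common line lets `h (x + y + z)` be
  -- expanded in two ways through independent pairs; `h z` then cancels.
  obtain ⟨z, hz, hxz⟩ := exists_linearIndependent_pair_of_apply_eq_one h3 hℓ hx'
  have hyz := hxz.pair_of_not hxy hy'
  lift z to LinearMap.ker ℓ using hz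
  have hx_yz : LinearIndependent F ![(x : V), ((y + z : LinearMap.ker ℓ) : V)] := by
    by_contra hcon
    rw [LinearIndependent.pair_iff' hx'] at hxy hxz hcon
    push Not at hxy hcon
    obtain ⟨c, hc⟩ := hxy
    obtain ⟨d, hd⟩ := hcon
    exact hxz (d - c) (by rw [sub_smul, hc, hd]; simp)
  have e1 : h (x + (y + z)) = h x + (h y + h z) := by rw [hadd _ _ hx_yz, hadd _ _ hyz]
  have e2 : h (x + y + z) = h (x + y) + h z := by
    by_cases hs : x + y = 0
    · rw [hs, h0 0 rfl, zero_add, zero_add]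
    · refine hadd _ _ (hxz.pair_of_not ?_ (by exact_mod_cast hs))
      rw [LinearIndependent.pair_iff' hx'] at hxy ⊢
      push Not at hxy ⊢
      obtain ⟨c, hc⟩ := hxy
      exact ⟨1 + c, by rw [add_smul, hc]; simp⟩
  rw [add_assoc, e1, ← add_assoc] at e2
  exact (add_right_cancel e2).symm

theorem exists_smul_of_normalizedImage_additive (h3 : 3 ≤ Module.finrank F V) (hℓ : ℓ a = 1)
    {h : LinearMap.ker ℓ →+ V} (hh : ∀ w : LinearMap.ker ℓ, IsNormalizedImage φ a a' (w : V) (h w)) :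
    ∃ υ : F →+* F, ∀ c w, h (c • w) = υ c • h w := by
  have hne : ∀ w : LinearMap.ker ℓ, w ≠ 0 → h w ≠ 0 := fun w hw =>
    ne_zero_of_map_span_eq (hh w).1 (by simpa using hw)
  have hscal : ∀ (c : F) (w : LinearMap.ker ℓ), ∃ d : F, d • h w = h (c • w) := by
    intro c w
    by_cases hc : c = 0
    · exact ⟨0, by simp [hc]⟩
    · refine exists_smul_eq_of_span_singleton_eq ?_
      rw [← (hh w).1, ← (hh (c • w)).1, Submodule.coe_smul, span_singleton_smul_eq_of_ne_zero hc]
  -- The factor by which `h` turns `c` into a scalar agrees on independent vectors: expand `h (c •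
  -- (x + y))` and compare coefficients of `h x` and `h y`.
  have hind : ∀ (c d : F) (x y : LinearMap.ker ℓ), LinearIndependent F ![(x : V), (y : V)] →
      h (c • x) = d • h x → h (c • y) = d • h y := by
    intro c d x y hxy hx
    obtain ⟨β, hβ⟩ := hscal c y
    obtain ⟨γ, hγ⟩ := hscal c (x + y)
    have := (hxy.map_span_pair (hh x).1 (hh y).1).pair_ext (a := γ) (b := γ) (c := d) (d := β)
      (by rw [hβ, ← hx, ← map_add, ← smul_add c, ← hγ, map_add, smul_add])
    rw [← hβ, ← this.2, this.1]
  have ha0 : a ≠ 0 := by rintro rfl; simp at hℓ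
  obtain ⟨x, hx, hax⟩ := exists_linearIndependent_pair_of_apply_eq_one h3 hℓ ha0
  have hx0 : x ≠ 0 := hax.ne_zero 1
  lift x to LinearMap.ker ℓ using hx
  choose υ hυ using fun c => hscal c x
  have hall : ∀ c w, h (c • w) = υ c • h w := by
    intro c w
    by_cases hw : w = 0
    · simp [hw]
    by_cases hxw : LinearIndependent F ![(x : V), (w : V)]
    · exact hind c _ x w hxw (hυ c).symm
    -- When `w` is parallel to `x`, the factor is carried over through a `z` independent of both.
    · obtain ⟨z, hz, hxz⟩ := exists_linearIndependent_pair_of_apply_eq_one h3 hℓ hx0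
      have hwz := hxz.pair_of_not hxw (by simpa using hw)
      lift z to LinearMap.ker ℓ using hz
      exact hind c _ z w (LinearIndependent.pair_symm_iff.1 hwz) (hind c _ x z hxz (hυ c).symm)
  have hx1 : h x ≠ 0 := hne x (by simpa using hx0)
  have hcancel : ∀ {c d : F}, c • h x = d • h x → c = d := fun e => smul_left_injective F hx1 e
  refine ⟨⟨⟨⟨υ, hcancel ?_⟩, fun c d => hcancel ?_⟩, hcancel ?_, fun c d => hcancel ?_⟩, hall⟩
  · rw [hυ, one_smul, one_smul]
  · rw [hυ, mul_smul, hall, hall, mul_smul]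
  · rw [hυ, zero_smul, zero_smul, map_zero]
  · change υ (c + d) • h x = (υ c + υ d) • h x
    rw [hυ, add_smul c d x, h.map_add, hall, hall, add_smul]

end Hyperplane

/-- The fundamental theorem of projective geometry over a finite field. -/
theorem exists_semilinear_of_orderIso [Finite F] (h3 : 3 ≤ Module.finrank F V)
    (φ : Submodule F V ≃o Submodule F V) :
    ∃ (υ : F ≃+* F) (g : V →ₛₗ[(υ : F →+* F)] V),
      ∀ v, φ (Submodule.span F {v}) = Submodule.span F {g v} := by
  have : Nontrivial V := Module.nontrivial_of_finrank_pos (R := F) (by omega)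
  obtain ⟨a, ha0⟩ := exists_ne (0 : V)
  obtain ⟨ℓ, hℓ⟩ := Module.Projective.exists_dual_ne_zero F ha0
  obtain ⟨ℓ, hℓ⟩ : ∃ ℓ : V →ₗ[F] F, ℓ a = 1 := ⟨(ℓ a)⁻¹ • ℓ, by simp [hℓ]⟩
  obtain ⟨a', ha⟩ := exists_map_span_singleton φ a
  obtain ⟨h, hh⟩ := exists_normalizedImage_additive h3 hℓ ha
  obtain ⟨υ, hυ⟩ := exists_smul_of_normalizedImage_additive h3 hℓ hh
  -- Finiteness of `F` makes the injective ring homomorphism `υ` an automorphism.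
  let υ' : F ≃+* F := RingEquiv.ofBijective υ (Finite.injective_iff_bijective.1 υ.injective)
  have hυ' : ∀ c, υ' c = υ c := fun _ => rfl
  let p : V →ₗ[F] LinearMap.ker ℓ := LinearMap.codRestrict (LinearMap.ker ℓ)
    (LinearMap.id - ℓ.smulRight a) (fun v => by simp [hℓ])
  have hp : ∀ v, (p v : V) = v - ℓ v • a := fun v => rfl
  refine ⟨υ', { toFun := fun v => υ (ℓ v) • a' + h (p v), map_add' := ?_, map_smul' := ?_ }, ?_⟩
  · intro x y
    simp only [map_add, add_smul]
    abel
  · intro c x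
    simp [hυ, hυ', mul_smul]
  · intro v
    change _ = Submodule.span F {υ (ℓ v) • a' + h (p v)}
    by_cases hv : ℓ v = 0
    · have := (hh (p v)).1
      rw [hp, hv, zero_smul, sub_zero] at this
      rw [this, hv, map_zero, zero_smul, zero_add]
    -- Here `v` is a nonzero multiple of `a + (ℓ v)⁻¹ • p v`, whose line is covered by the
    -- normalisation.
    · have hυv : υ (ℓ v) ≠ 0 := by simpa using hv
      have := (hh ((ℓ v)⁻¹ • p v)).2
      rw [hυ, Submodule.coe_smul, hp, ← span_singleton_smul_eq_of_ne_zero hυv (a' + _),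
        ← span_singleton_smul_eq_of_ne_zero hv (a + _), smul_add, smul_add, smul_smul, smul_smul,
        map_inv₀, mul_inv_cancel₀ hv, mul_inv_cancel₀ hυv, one_smul, one_smul] at this
      rw [← this, add_sub_cancel]

end FundamentalTheorem

/-! ### From semilinear maps back to matrices, and the main theorem. -/

/-- An automorphism of the subspace lattice of `F ^ n` is induced by a field automorphism and an
invertible matrix. -/
theorem exists_rowSpace_eq_of_orderIso {F : Type*} [Field F] [Finite F] {n : ℕ} (hn : 3 ≤ n)
    (φ : Submodule F (Fin n → F) ≃o Submodule F (Fin n → F)) :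
    ∃ (P : GL (Fin n) F) (υ : F ≃+* F), ∀ X : Matrix (Fin n) (Fin n) F,
      rowSpace (rightMulPerm P (entrywisePerm n υ X)) = φ (rowSpace X) := by
  obtain ⟨υ, g, hg⟩ := exists_semilinear_of_orderIso (by simpa using hn) φ
  -- The rows of `Q` are the images of the standard basis, so `g` is `υ` on coordinates followed by
  -- right multiplication by `Q`. It is invertible because `φ` sends no line to `⊥`.
  let Q : Matrix (Fin n) (Fin n) F := Matrix.of fun i => g (Pi.single i 1)
  have hQ : ∀ v, Matrix.vecMul (υ ∘ v) Q = g v := by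
    intro v
    conv_rhs => rw [pi_eq_sum_univ' v]
    rw [Matrix.vecMul_eq_sum, map_sum]
    refine Finset.sum_congr rfl fun i _ => ?_
    rw [LinearMap.map_smulₛₗ]
    rfl
  have hinj : Function.Injective (fun v => Matrix.vecMul v Q) := by
    refine (injective_iff_map_eq_zero (Q.vecMulLinear)).2 fun v hv => ?_
    have h1 : g (υ.symm ∘ v) = 0 := by
      rw [← hQ, ← Function.comp_assoc, show υ ∘ υ.symm = id from funext υ.apply_symm_apply,
        Function.id_comp]
      exact hv
    by_contra hv0
    refine ne_zero_of_map_span_eq (hg (υ.symm ∘ v)) (fun e => hv0 ?_) h1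
    ext i
    simpa using congrFun e i
  obtain ⟨P, hP⟩ := Matrix.vecMul_injective_iff_isUnit.1 hinj
  refine ⟨P, υ, fun X => ?_⟩
  -- A row space is the supremum of its row lines, and `φ` commutes with suprema, so knowing `φ` on
  -- lines is enough.
  rw [rowSpace, rowSpace, map_iSup]
  refine iSup_congr fun i => ?_
  rw [hg, ← hQ, ← hP]
  rfl

theorem mainTheorem1 {F : Type*} [Field F] [Finite F] (n : ℕ) :
    (∀ P : GL (Fin n) F,
      rightMulPerm P ∈ digraphAut (leftIdealRelationDigraph (Matrix (Fin n) (Fin n) F))) ∧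
    (∀ υ : F ≃+* F,
      entrywisePerm n υ ∈ digraphAut (leftIdealRelationDigraph (Matrix (Fin n) (Fin n) F))) ∧
    (∀ σ : Equiv.Perm (Matrix (Fin n) (Fin n) F), PermutesLeftIdealClasses σ →
      σ ∈ digraphAut (leftIdealRelationDigraph (Matrix (Fin n) (Fin n) F))) ∧
    (3 ≤ n →
      ∀ Ψ ∈ digraphAut (leftIdealRelationDigraph (Matrix (Fin n) (Fin n) F)),
        ∃ (P : GL (Fin n) F) (υ : F ≃+* F) (σ : Equiv.Perm (Matrix (Fin n) (Fin n) F)),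
          PermutesLeftIdealClasses σ ∧
          Ψ = rightMulPerm P * entrywisePerm n υ * σ) := by

  refine ⟨fun P => mem_digraphAut_of_le_iff fun X Y => ?_,
    fun υ => mem_digraphAut_of_le_iff fun X Y => ?_,
    fun σ hσ => mem_digraphAut_of_le_iff fun X Y => by rw [hσ, hσ], fun hn Ψ hΨ => ?_⟩
  · rw [Ideal.span_singleton_le_iff_exists_mul, Ideal.span_singleton_le_iff_exists_mul]
    refine exists_congr fun A => ?_
    change A * (Y * _) = X * _ ↔ _
    rw [← mul_assoc, Units.mul_left_inj]
  · rw [Ideal.span_singleton_le_iff_exists_mul, Ideal.span_singleton_le_iff_exists_mul]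
    rw [(entrywisePerm n υ).surjective.exists]
    refine exists_congr fun A => ?_
    change A.map υ * Y.map υ = X.map υ ↔ _
    rw [← Matrix.map_mul, (Matrix.map_injective υ.injective).eq_iff]
  · obtain ⟨φ, hφ⟩ := exists_orderIso_of_lt_iff (F := F) (V := Fin n → F) (by simpa using hn)
      rowSpace_surjective Ψ (fun X Y => by
        simpa only [leftIdealRelationDigraph_adj, span_lt_span_iff_rowSpace_lt] using hΨ X Y)
    obtain ⟨P, υ, hP⟩ := exists_rowSpace_eq_of_orderIso hn φ
    -- The factorisation forces this `σ`. Applying `φ` to the row space of `σ X` gives that of `Ψ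
    -- X`, which is `φ (rowSpace X)`.
    refine ⟨P, υ, (rightMulPerm P * entrywisePerm n υ)⁻¹ * Ψ, fun X => ?_,
      (mul_inv_cancel_left _ _).symm⟩
    rw [span_eq_span_iff_rowSpace_eq, ← φ.injective.eq_iff, ← hP, ← Equiv.Perm.mul_apply,
      ← Equiv.Perm.mul_apply, mul_inv_cancel_left, hφ]
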